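/- Let $\mathcal H$ be a finite-dimensional complex Hilbert space and let $f:(0,\infty)\to\mathbb R$ be operator convex, i.e. $f(tA+(1-t)B)\le t f(A)+(1-t)f(B)$ for all $0\le t\le 1$ and all positive invertible operators $A,B$ on any (finite- or infinite-dimensional) complex Hilbert space. Write $f(0^+)=\lim_{x\searrow 0}f(x)$ and $f'(+\infty)=\lim_{x\to+\infty}f(x)/x$; both limits exist in $(-\infty,+\infty]$. Let $\widetilde f(y)=y f(1/y)$, $y>0$, be the transpose of $f$; it satisfies $\widetilde f(0^+)=f'(+\infty)$. For a positive operator $A$ with spectral decomposition $A=\sum_a aP_a$ put $A^t=\sum_{a>0}a^tP_a$ for $t\in\mathbb R$; in particular $A^0$ is the support projection of $A$, and negative powers are powers of the generalized inverse. For positive invertible $A,B$ let $$P_f(A,B)=B^{1/2}f\bigl(B^{-1/2}AB^{-1/2}\bigr)B^{1/2}$$ be the operator perspective of $f$. Let $\varrho,\sigma\ge 0$ be operators on $\mathcal H$. Call a sequence $(K_n)_{n\in\mathbb N}$ of operators on $\mathcal H$ admissible if $K_n\ge 0$, $\varrho+K_n$ and $\sigma+K_n$ are invertible for every $n$, and $K_n\to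 0$. 1. If $f(0^+)<+\infty$ and $\varrho^0\le\sigma^0$, then for every admissible $(K_n)$ $$\lim_{n\to\infty}P_f(\varrho+K_n,\sigma+K_n)=\sigma^{1/2}f\bigl(\sigma^{-1/2}\varrho\,\sigma^{-1/2}\bigr)\sigma^{1/2},\qquad(\ast)$$ where $f(0):=f(0^+)$. 2. If $f'(+\infty)<+\infty$ and $\sigma^0\le\varrho^0$, then for every admissible $(K_n)$ $$\lim_{n\to\infty}P_f(\varrho+K_n,\sigma+K_n)=\varrho^{1/2}\widetilde f\bigl(\varrho^{-1/2}\sigma\varrho^{-1/2}\bigr)\varrho^{1/2},\qquad(\ast\ast)$$ where $\widetilde f(0):=f'(+\infty)$. 3. If $\varrho^0=\sigma^0$, then both $(\ast)$ and $(\ast\ast)$ hold for every admissible $(K_n)$, without any assumption on $f(0^+)$ and $f'(+\infty)$; here $f(0)$ and $\widetilde f(0)$ may be given any real value, which does not affect the right-hand sides. Consequently, in each of these three cases there is exactly one operator $P_f(\varrho,\sigma)$ with $P_f(\varrho+K_n,\sigma+K_n)\to P_f(\varrho,\sigma)$ for every admissible $(K_n)$, and if $\varrho$ and $\sigma$ are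 invertible, it coincides with the operator perspective defined above. -/

import Mathlib

open Filter Topology

universe u

noncomputable section

namespace OperatorPerspective

/-- `f : (0, ∞) → ℝ` is operator convex: `f(tA + (1-t)B) ≤ t f(A) + (1-t) f(B)` in the Loewner order,
for all positive invertible operators `A`, `B` on any complex Hilbert space, of finite or infinite
dimension. Only the values of `f` on `(0, ∞)` matter. (One-dimensional spaces already force `f` to be
convex, hence continuous, on `(0, ∞)`, so that `cfc` is the usual functional calculus.) -/
def OperatorConvex (f : ℝ → ℝ) : Prop :=
  ∀ (H : Type u) [NormedAddCommGroup H] [InnerProductSpace ℂ H] [CompleteSpace H]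
    (A B : H →L[ℂ] H), IsStrictlyPositive A → IsStrictlyPositive B →
    ∀ t : ℝ, 0 ≤ t → t ≤ 1 →
      cfc f (t • A + (1 - t) • B) ≤ t • cfc f A + (1 - t) • cfc f B

/-- The transpose `y ↦ y f(1/y)`, for `y > 0`. -/
def transpose (f : ℝ → ℝ) : ℝ → ℝ := fun y => y * f (1 / y)

/-- The function on `[0, ∞)` that agrees with `f` on `(0, ∞)` and takes the value `c` at `0`. -/
def extendAtZero (f : ℝ → ℝ) (c : ℝ) : ℝ → ℝ := Function.update f 0 c

variable {H : Type u} [NormedAddCommGroup H] [InnerProductSpace ℂ H] [CompleteSpace H]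

/-- Real powers of a positive operator on a finite-dimensional space, `A ^ t = ∑_{a > 0} a ^ t P_a`,
taken on the support of `A`: negative powers are powers of the generalized inverse. -/
def pow (A : H →L[ℂ] H) (t : ℝ) : H →L[ℂ] H := cfc (fun a : ℝ => if 0 < a then a ^ t else 0) A

/-- The support projection `A ^ 0`. -/
def supp (A : H →L[ℂ] H) : H →L[ℂ] H := pow A 0

/-- The expression `B^{1/2} φ(B^{-1/2} A B^{-1/2}) B^{1/2}`. For positive invertible `A`, `B` this is
the operator perspective of `φ`, and it depends only on the values of `φ` on `(0, ∞)`; for other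
positive `A`, `B` it also uses the value `φ 0`. -/
def persp (φ : ℝ → ℝ) (A B : H →L[ℂ] H) : H →L[ℂ] H :=
  pow B (1 / 2) * cfc φ (pow B (-(1 / 2)) * A * pow B (-(1 / 2))) * pow B (1 / 2)

/-- `K_n ≥ 0` tends to `0`, and `ρ + K_n`, `σ + K_n` are positive and invertible for every `n`. -/
structure IsAdmissible (ρ σ : H →L[ℂ] H) (K : ℕ → (H →L[ℂ] H)) : Prop where
  nonneg : ∀ n, 0 ≤ K n
  left_pos : ∀ n, IsStrictlyPositive (ρ + K n)
  right_pos : ∀ n, IsStrictlyPositive (σ + K n)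
  tendsto_zero : Tendsto K atTop (𝓝 0)

/-- `P_f(ρ + K_n, σ + K_n) → L` for every admissible sequence `K`. -/
def PerspTendsto (f : ℝ → ℝ) (ρ σ L : H →L[ℂ] H) : Prop :=
  ∀ K : ℕ → (H →L[ℂ] H), IsAdmissible ρ σ K →
    Tendsto (fun n => persp f (ρ + K n) (σ + K n)) atTop (𝓝 L)

end OperatorPerspective

end

/-!
The proof squeezes the perspective between two bounds that both come from one inequality,
`PerspConvex`: for positive invertible `A_i`, `B_i` and arbitrary `C_i`,
`P(∑ C_i* A_i C_i, ∑ C_i* B_i C_i) ≤ ∑ C_i* P(A_i, B_i) C_i`.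
For an operator convex function it is Jensen's operator inequality with the weights
`B_i^{1/2} C_i B^{-1/2}`, where `B = ∑ C_i* B_i C_i`. Jensen's inequality is in turn operator
convexity on `H ⊕ H` applied to an operator and its conjugate by the reflection in the range of an
isometry (`OperatorConvex.cfc_compression_le`).

Write `S` for the support of `σ` and let `supp ρ ≤ S`. With `C_i = 1` the inequality is
subadditivity, and as `P(K, K) = f(1) K` it bounds `P(ρ + K, σ + K)` from above by
`P(ρ, σ) + f(1) K` (`PerspConvex.persp_add_le`). With `C_1 = S`, `C_2 = 1 - S` it says that pinching
by `S` decreases the perspective; the pinched operators are block diagonal, `σ` is invertible on the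
range of `S`, and on the complement both arguments are equal, so that the perspective of the pinched
operators tends to `P(ρ, σ)` by continuity of the functional calculus (`tendsto_persp_of_block`).
Hence the nonnegative defects `D_n = P(ρ, σ) + f(1) K_n - P(ρ + K_n, σ + K_n)` have pinchings
tending to zero, and `D_n` is at most twice its pinching (`le_two_smul_pinch`), so `D_n → 0`. This
gives the limit when `f` extends continuously to `0`, and also when `supp ρ = S`, since then `ρ` is
invertible on the range of `S` too and only values of `f` on `(0, ∞)` enter.

The statements about the transpose follow by symmetry, since `P_f(A, B)` is the perspective of the
transpose of `f` at `(B, A)` (`persp_transpose`), so the transpose satisfies the same inequality.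

In finite dimension every function agrees with a polynomial on a finite set of eigenvalues; hence an
intertwiner of two self-adjoint operators intertwines all functions of them
(`cfc_comp_of_intertwine`), which is how block decompositions and similarities pass through the
functional calculus.
-/

noncomputable section

namespace OperatorPerspective

open ContinuousLinearMap

/-! ### Functional calculus and intertwiners in finite dimension -/

section Intertwine

variable {E F : Type*} [NormedAddCommGroup E] [InnerProductSpace ℂ E]
  [NormedAddCommGroup F] [InnerProductSpace ℂ F]

lemma aeval_comp_of_intertwine {A : E →L[ℂ] E} {B : F →L[ℂ] F} {V : F →L[ℂ] E}
    (h : A ∘L V = V ∘L B) (p : Polynomial ℝ) :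
    Polynomial.aeval A p ∘L V = V ∘L Polynomial.aeval B p := by
  have hpow (n : ℕ) : (A ^ n) ∘L V = V ∘L (B ^ n) := by
    induction n with
    | zero => ext x; simp
    | succ n ih =>
      rw [pow_succ, pow_succ', mul_def, mul_def, comp_assoc, h, ← comp_assoc, ih, comp_assoc,
        ← mul_def B, ← mul_def (B ^ n), ← pow_succ, ← pow_succ']
  induction p using Polynomial.induction_on' with
  | add p q hp hq => simp only [map_add, add_comp, comp_add, hp, hq]
  | monomial n a =>
    simp only [Polynomial.aeval_monomial, ← Algebra.smul_def]
    rw [smul_comp, hpow, comp_smul]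

variable [CompleteSpace E] [FiniteDimensional ℂ E] [CompleteSpace F] [FiniteDimensional ℂ F]

lemma finite_real_spectrum (A : E →L[ℂ] E) : (spectrum ℝ A).Finite := by
  have h : (spectrum ℂ A).Finite := by
    rw [ContinuousLinearMap.spectrum_eq]
    exact Module.End.finite_spectrum _
  rw [← spectrum.preimage_algebraMap ℂ]
  exact h.preimage (FaithfulSMul.algebraMap_injective ℝ ℂ).injOn

lemma continuousOn_real_spectrum (g : ℝ → ℝ) (A : E →L[ℂ] E) : ContinuousOn g (spectrum ℝ A) :=
  (finite_real_spectrum A).continuousOn g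

/-- An operator that intertwines two self-adjoint operators intertwines their images under every
function: on the union of the two finite spectra the function agrees with a polynomial. -/
lemma cfc_comp_of_intertwine {A : E →L[ℂ] E} {B : F →L[ℂ] F} {V : F →L[ℂ] E}
    (hA : IsSelfAdjoint A) (hB : IsSelfAdjoint B) (h : A ∘L V = V ∘L B) (g : ℝ → ℝ) :
    cfc g A ∘L V = V ∘L cfc g B := by
  classical
  set s : Finset ℝ := (finite_real_spectrum A).toFinset ∪ (finite_real_spectrum B).toFinset
  set p : Polynomial ℝ := Lagrange.interpolate s id g
  have hp (x : ℝ) (hx : x ∈ s) : g x = p.eval x :=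
    (Lagrange.eval_interpolate_at_node g Function.injective_id.injOn hx).symm
  have h1 : cfc g A = Polynomial.aeval A p := by
    rw [← cfc_polynomial p A hA]
    exact cfc_congr fun x hx => hp x (by simp [s, hx])
  have h2 : cfc g B = Polynomial.aeval B p := by
    rw [← cfc_polynomial p B hB]
    exact cfc_congr fun x hx => hp x (by simp [s, hx])
  rw [h1, h2, aeval_comp_of_intertwine h]

lemma cfc_mul_of_intertwine {A B X : E →L[ℂ] E} (hA : IsSelfAdjoint A) (hB : IsSelfAdjoint B)
    (h : A * X = X * B) (g : ℝ → ℝ) : cfc g A * X = X * cfc g B :=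
  cfc_comp_of_intertwine hA hB h g

end Intertwine

/-! ### Jensen's operator inequality -/

section Jensen

variable {E F : Type u} [NormedAddCommGroup E] [InnerProductSpace ℂ E] [CompleteSpace E]
  [NormedAddCommGroup F] [InnerProductSpace ℂ F] [CompleteSpace F]

lemma adjoint_comp_mono {X Y : E →L[ℂ] E} (h : X ≤ Y) (V : F →L[ℂ] E) :
    (adjoint V) ∘L X ∘L V ≤ (adjoint V) ∘L Y ∘L V := by
  rw [ContinuousLinearMap.le_def] at h ⊢
  have := h.adjoint_conj V
  simpa [sub_comp, comp_sub] using this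

lemma midpoint_reflection_comp {X : E →L[ℂ] E} {V : F →L[ℂ] E} {U : E →L[ℂ] E}
    (hU : U = (2 : ℝ) • (V ∘L adjoint V) - 1) (hUV : U ∘L V = V) :
    ((1 / 2 : ℝ) • X + (1 - 1 / 2 : ℝ) • (U * X * U)) ∘L V = V ∘L (adjoint V ∘L X ∘L V) := by
  ext x
  have h1 : U (V x) = V x := congrArg (fun T : F →L[ℂ] E => T x) hUV
  have h2 : U (X (V x)) = (2 : ℝ) • V (adjoint V (X (V x))) - X (V x) := by rw [hU]; simp
  simp only [comp_apply, add_apply, smul_apply, mul_apply_eq_comp, h1, h2]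
  module

variable [FiniteDimensional ℂ E] [FiniteDimensional ℂ F]

/-- Jensen's inequality for compression by an isometry `V : F → E`. The reflection `U = 2VV* - 1`
averages `X` to an operator that is block diagonal for the range of `V`. -/
lemma OperatorConvex.cfc_compression_le {f : ℝ → ℝ} (hf : OperatorConvex.{u} f)
    {X : E →L[ℂ] E} (hX : IsStrictlyPositive X) {V : F →L[ℂ] E}
    (hV : adjoint V ∘L V = ContinuousLinearMap.id ℂ F) :
    cfc f (adjoint V ∘L X ∘L V) ≤ adjoint V ∘L cfc f X ∘L V := by
  obtain ⟨P, hP⟩ : ∃ P : E →L[ℂ] E, P = V ∘L adjoint V := ⟨_, rfl⟩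
  obtain ⟨U, hU⟩ : ∃ U : E →L[ℂ] E, U = (2 : ℝ) • P - 1 := ⟨_, rfl⟩
  have hPsa : star P = P := by
    simp [hP, star_eq_adjoint, adjoint_comp]
  have hPP : P * P = P := by
    rw [hP, mul_def, comp_assoc, ← comp_assoc (adjoint V), hV, id_comp]
  have hUsa : star U = U := by simp [hU, hPsa]
  have hUU : U * U = 1 := by
    simp only [hU, mul_sub, sub_mul, mul_smul_comm, smul_mul_assoc, hPP, mul_one, one_mul]
    module
  have hPV : P ∘L V = V := by rw [hP, comp_assoc, hV, comp_id]
  have hUV : U ∘L V = V := by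
    rw [hU, sub_comp, smul_comp, hPV, two_smul]
    ext x; simp
  have hUX : IsStrictlyPositive (U * X * U) := by
    have hu : IsUnit U := ⟨⟨U, U, hUU, hUU⟩, rfl⟩
    have := (hu.isStrictlyPositive_star_left_conjugate_iff (a := X)).2 hX
    rwa [hUsa] at this
  have hfU : cfc f (U * X * U) = U * cfc f X * U := by
    have := cfc_mul_of_intertwine hUX.isSelfAdjoint hX.isSelfAdjoint (X := U)
      (by rw [mul_assoc, hUU, mul_one]) f
    rw [← this, mul_assoc (cfc f _), hUU, mul_one]
  obtain ⟨Y, hY⟩ : ∃ Y : E →L[ℂ] E, Y = (1 / 2 : ℝ) • X + (1 - 1 / 2 : ℝ) • (U * X * U) :=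
    ⟨_, rfl⟩
  have hYle := hf E X (U * X * U) hX hUX (1 / 2) (by norm_num) (by norm_num)
  rw [hfU, ← hY] at hYle
  have hYsa : IsSelfAdjoint Y := by
    rw [hY]
    exact ((IsSelfAdjoint.all _).smul hX.isSelfAdjoint).add
      ((IsSelfAdjoint.all _).smul hUX.isSelfAdjoint)
  have hYV : Y ∘L V = V ∘L (adjoint V ∘L X ∘L V) := by
    rw [hY]
    exact midpoint_reflection_comp (by rw [hU, hP]) hUV
  have hZsa : IsSelfAdjoint (adjoint V ∘L X ∘L V) := hX.isSelfAdjoint.adjoint_conj V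
  have hfY := cfc_comp_of_intertwine hYsa hZsa hYV f
  have hVU : adjoint V ∘L U = adjoint V := by
    have := congrArg adjoint hUV
    rwa [adjoint_comp, ← star_eq_adjoint U, hUsa] at this
  have h1 : adjoint V ∘L cfc f Y ∘L V = cfc f (adjoint V ∘L X ∘L V) := by
    rw [hfY, ← comp_assoc, hV, id_comp]
  have h2 : adjoint V ∘L (U * cfc f X * U) ∘L V = adjoint V ∘L cfc f X ∘L V := by
    rw [mul_def, mul_def, comp_assoc, comp_assoc, hUV, ← comp_assoc, hVU]
  have h3 := adjoint_comp_mono hYle V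
  rw [h1, add_comp, smul_comp, smul_comp, comp_add, comp_smul, comp_smul, h2, ← add_smul] at h3
  norm_num at h3
  exact h3

end Jensen

/-! ### The Hilbert sum of two copies and the two-term Jensen inequality -/

section TwoTermJensen

variable {E F : Type u} [NormedAddCommGroup E] [InnerProductSpace ℂ E] [CompleteSpace E]
  [NormedAddCommGroup F] [InnerProductSpace ℂ F] [CompleteSpace F]

variable (E) in
/-- The isometric embedding of `E` as the first summand of the Hilbert sum `E ⊕ E`. -/
def inclFst : E →L[ℂ] WithLp 2 (E × E) :=
  ((WithLp.prodContinuousLinearEquiv 2 ℂ E E).symm : E × E →L[ℂ] WithLp 2 (E × E)) ∘L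
    ContinuousLinearMap.inl ℂ E E

variable (E) in
/-- The isometric embedding of `E` as the second summand of the Hilbert sum `E ⊕ E`. -/
def inclSnd : E →L[ℂ] WithLp 2 (E × E) :=
  ((WithLp.prodContinuousLinearEquiv 2 ℂ E E).symm : E × E →L[ℂ] WithLp 2 (E × E)) ∘L
    ContinuousLinearMap.inr ℂ E E

lemma adjoint_inclFst : adjoint (inclFst E) = ContinuousLinearMap.fst ℂ E E ∘L
    ((WithLp.prodContinuousLinearEquiv 2 ℂ E E) : WithLp 2 (E × E) →L[ℂ] E × E) := by
  symm
  rw [eq_adjoint_iff]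
  intro x y
  simp [inclFst, WithLp.prod_inner_apply]

lemma adjoint_inclSnd : adjoint (inclSnd E) = ContinuousLinearMap.snd ℂ E E ∘L
    ((WithLp.prodContinuousLinearEquiv 2 ℂ E E) : WithLp 2 (E × E) →L[ℂ] E × E) := by
  symm
  rw [eq_adjoint_iff]
  intro x y
  simp [inclSnd, WithLp.prod_inner_apply]

lemma adjoint_inclFst_comp_inclFst :
    adjoint (inclFst E) ∘L inclFst E = ContinuousLinearMap.id ℂ E := by
  rw [adjoint_inclFst]; ext x; simp [inclFst]

lemma adjoint_inclSnd_comp_inclSnd :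
    adjoint (inclSnd E) ∘L inclSnd E = ContinuousLinearMap.id ℂ E := by
  rw [adjoint_inclSnd]; ext x; simp [inclSnd]

lemma adjoint_inclFst_comp_inclSnd : adjoint (inclFst E) ∘L inclSnd E = 0 := by
  rw [adjoint_inclFst]; ext x; simp [inclSnd]

lemma adjoint_inclSnd_comp_inclFst : adjoint (inclSnd E) ∘L inclFst E = 0 := by
  rw [adjoint_inclSnd]; ext x; simp [inclFst]

lemma inclFst_add_inclSnd :
    inclFst E ∘L adjoint (inclFst E) + inclSnd E ∘L adjoint (inclSnd E) = 1 := by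
  rw [adjoint_inclFst, adjoint_inclSnd]
  ext x
  apply (WithLp.equiv 2 (E × E)).injective
  simp [inclFst, inclSnd, ← WithLp.toLp_add]
  rfl

/-- The block diagonal operator `X₁ ⊕ X₂` on `E ⊕ E`. -/
def blockDiag (X₁ X₂ : E →L[ℂ] E) : WithLp 2 (E × E) →L[ℂ] WithLp 2 (E × E) :=
  inclFst E ∘L X₁ ∘L adjoint (inclFst E) + inclSnd E ∘L X₂ ∘L adjoint (inclSnd E)

lemma blockDiag_comp_inclFst (X₁ X₂ : E →L[ℂ] E) :
    blockDiag X₁ X₂ ∘L inclFst E = inclFst E ∘L X₁ := by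
  simp only [blockDiag, add_comp, comp_assoc, adjoint_inclFst_comp_inclFst,
    adjoint_inclSnd_comp_inclFst, comp_zero, add_zero, comp_id]

lemma blockDiag_comp_inclSnd (X₁ X₂ : E →L[ℂ] E) :
    blockDiag X₁ X₂ ∘L inclSnd E = inclSnd E ∘L X₂ := by
  simp only [blockDiag, add_comp, comp_assoc, adjoint_inclSnd_comp_inclSnd,
    adjoint_inclFst_comp_inclSnd, comp_zero, zero_add, comp_id]

lemma blockDiag_mul (X₁ X₂ Y₁ Y₂ : E →L[ℂ] E) :
    blockDiag X₁ X₂ * blockDiag Y₁ Y₂ = blockDiag (X₁ * Y₁) (X₂ * Y₂) := by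
  conv_lhs => rw [blockDiag.eq_def Y₁]
  rw [mul_def, comp_add, ← comp_assoc _ (inclFst E), blockDiag_comp_inclFst,
    ← comp_assoc _ (inclSnd E), blockDiag_comp_inclSnd]
  rfl

lemma blockDiag_one : blockDiag (1 : E →L[ℂ] E) 1 = 1 := by
  rw [← inclFst_add_inclSnd]; rfl

lemma isStrictlyPositive_blockDiag {X₁ X₂ : E →L[ℂ] E} (h₁ : IsStrictlyPositive X₁)
    (h₂ : IsStrictlyPositive X₂) : IsStrictlyPositive (blockDiag X₁ X₂) := by
  refine IsUnit.isStrictlyPositive ?_ ?_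
  · obtain ⟨u, hu⟩ := h₁.isUnit
    obtain ⟨v, hv⟩ := h₂.isUnit
    refine ⟨⟨blockDiag X₁ X₂, blockDiag ↑u⁻¹ ↑v⁻¹, ?_, ?_⟩, rfl⟩
    · rw [blockDiag_mul, ← hu, ← hv, Units.mul_inv, Units.mul_inv, blockDiag_one]
    · rw [blockDiag_mul, ← hu, ← hv, Units.inv_mul, Units.inv_mul, blockDiag_one]
  · have p₁ := (nonneg_iff_isPositive X₁).1 h₁.nonneg
    have p₂ := (nonneg_iff_isPositive X₂).1 h₂.nonneg
    exact (nonneg_iff_isPositive _).2 ((p₁.conj_adjoint _).add (p₂.conj_adjoint _))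

lemma adjoint_comp_blockDiag_comp (X₁ X₂ V₁ V₂ : E →L[ℂ] E) :
    adjoint (inclFst E ∘L V₁ + inclSnd E ∘L V₂) ∘L blockDiag X₁ X₂ ∘L
      (inclFst E ∘L V₁ + inclSnd E ∘L V₂) = star V₁ * X₁ * V₁ + star V₂ * X₂ * V₂ := by
  have h : blockDiag X₁ X₂ ∘L (inclFst E ∘L V₁ + inclSnd E ∘L V₂) =
      inclFst E ∘L (X₁ ∘L V₁) + inclSnd E ∘L (X₂ ∘L V₂) := by
    rw [comp_add, ← comp_assoc, blockDiag_comp_inclFst, ← comp_assoc, blockDiag_comp_inclSnd]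
    rfl
  rw [h, map_add, adjoint_comp, adjoint_comp]
  have h11 (Z : E →L[ℂ] E) : adjoint (inclFst E) ∘L inclFst E ∘L Z = Z := by
    rw [← comp_assoc, adjoint_inclFst_comp_inclFst, id_comp]
  have h22 (Z : E →L[ℂ] E) : adjoint (inclSnd E) ∘L inclSnd E ∘L Z = Z := by
    rw [← comp_assoc, adjoint_inclSnd_comp_inclSnd, id_comp]
  have h12 (Z : E →L[ℂ] E) : adjoint (inclFst E) ∘L inclSnd E ∘L Z = 0 := by
    rw [← comp_assoc, adjoint_inclFst_comp_inclSnd, zero_comp]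
  have h21 (Z : E →L[ℂ] E) : adjoint (inclSnd E) ∘L inclFst E ∘L Z = 0 := by
    rw [← comp_assoc, adjoint_inclSnd_comp_inclFst, zero_comp]
  simp only [comp_add, add_comp, comp_assoc, h11, h22, h12, h21, comp_zero, add_zero, zero_add,
    mul_def, star_eq_adjoint]

variable [FiniteDimensional ℂ E]

instance : FiniteDimensional ℂ (WithLp 2 (E × E)) :=
  (WithLp.prodContinuousLinearEquiv 2 ℂ E E).symm.toLinearEquiv.finiteDimensional

lemma cfc_blockDiag {X₁ X₂ : E →L[ℂ] E} (h₁ : IsStrictlyPositive X₁)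
    (h₂ : IsStrictlyPositive X₂) (g : ℝ → ℝ) :
    cfc g (blockDiag X₁ X₂) = blockDiag (cfc g X₁) (cfc g X₂) := by
  have hX := (isStrictlyPositive_blockDiag h₁ h₂).isSelfAdjoint
  have e₁ := cfc_comp_of_intertwine hX h₁.isSelfAdjoint (blockDiag_comp_inclFst X₁ X₂) g
  have e₂ := cfc_comp_of_intertwine hX h₂.isSelfAdjoint (blockDiag_comp_inclSnd X₁ X₂) g
  calc cfc g (blockDiag X₁ X₂)
      = cfc g (blockDiag X₁ X₂) ∘L
          (inclFst E ∘L adjoint (inclFst E) + inclSnd E ∘L adjoint (inclSnd E)) := by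
        rw [inclFst_add_inclSnd, ← mul_def, mul_one]
    _ = blockDiag (cfc g X₁) (cfc g X₂) := by
        rw [comp_add, ← comp_assoc, e₁, ← comp_assoc, e₂]
        rfl

/-- Two-term Jensen inequality: the compression of `X₁ ⊕ X₂` by the isometry `x ↦ (V₁ x, V₂ x)`. -/
lemma OperatorConvex.cfc_add_le {f : ℝ → ℝ} (hf : OperatorConvex.{u} f)
    {X₁ X₂ V₁ V₂ : E →L[ℂ] E} (h₁ : IsStrictlyPositive X₁) (h₂ : IsStrictlyPositive X₂)
    (hV : star V₁ * V₁ + star V₂ * V₂ = 1) :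
    cfc f (star V₁ * X₁ * V₁ + star V₂ * X₂ * V₂) ≤
      star V₁ * cfc f X₁ * V₁ + star V₂ * cfc f X₂ * V₂ := by
  have hiso : adjoint (inclFst E ∘L V₁ + inclSnd E ∘L V₂) ∘L
      (inclFst E ∘L V₁ + inclSnd E ∘L V₂) = ContinuousLinearMap.id ℂ E := by
    have := adjoint_comp_blockDiag_comp 1 1 V₁ V₂
    rwa [blockDiag_one, mul_one, mul_one, hV, one_def, id_comp] at this
  have := hf.cfc_compression_le (X := blockDiag X₁ X₂) (isStrictlyPositive_blockDiag h₁ h₂) hiso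
  rwa [cfc_blockDiag h₁ h₂, adjoint_comp_blockDiag_comp, adjoint_comp_blockDiag_comp] at this

end TwoTermJensen

section Perspective

variable {H : Type u} [NormedAddCommGroup H] [InnerProductSpace ℂ H] [CompleteSpace H]

/-! ### Powers and perspectives of strictly positive operators -/

lemma isSelfAdjoint_pow (A : H →L[ℂ] H) (t : ℝ) : IsSelfAdjoint (pow A t) :=
  cfc_predicate _ _

lemma star_pow (A : H →L[ℂ] H) (t : ℝ) : star (pow A t) = pow A t := isSelfAdjoint_pow A t

variable [FiniteDimensional ℂ H]

lemma pow_mul_pow (A : H →L[ℂ] H) (s t : ℝ) : pow A s * pow A t = pow A (s + t) := by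
  rw [pow, pow, ← cfc_mul _ _ A (continuousOn_real_spectrum _ _) (continuousOn_real_spectrum _ _)]
  refine cfc_congr fun x _ => ?_
  by_cases h : 0 < x
  · simp [h, Real.rpow_add h]
  · simp [h]

omit [FiniteDimensional ℂ H] in
lemma pow_one {A : H →L[ℂ] H} (hA : 0 ≤ A) : pow A 1 = A := by
  conv_rhs => rw [← cfc_id' ℝ A (IsSelfAdjoint.of_nonneg hA)]
  refine cfc_congr fun x hx => ?_
  have h0 : 0 ≤ x := spectrum_nonneg_of_nonneg hA hx
  rcases h0.lt_or_eq with h | h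
  · simp [h]
  · simp [← h]

omit [FiniteDimensional ℂ H] in
lemma pow_zero {A : H →L[ℂ] H} (hA : IsStrictlyPositive A) : pow A 0 = 1 := by
  rw [← cfc_const_one ℝ A hA.isSelfAdjoint]
  exact cfc_congr fun x hx => by simp [hA.spectrum_pos hx]

lemma sqrt_mul_sqrt {A : H →L[ℂ] H} (hA : 0 ≤ A) : pow A (1 / 2) * pow A (1 / 2) = A := by
  rw [pow_mul_pow]; norm_num [pow_one hA]

lemma sqrt_mul_invSqrt {A : H →L[ℂ] H} (hA : IsStrictlyPositive A) :
    pow A (1 / 2) * pow A (-(1 / 2)) = 1 := by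
  rw [pow_mul_pow, add_neg_cancel, pow_zero hA]

lemma invSqrt_mul_sqrt {A : H →L[ℂ] H} (hA : IsStrictlyPositive A) :
    pow A (-(1 / 2)) * pow A (1 / 2) = 1 := by
  rw [pow_mul_pow, neg_add_cancel, pow_zero hA]

lemma isUnit_invSqrt {A : H →L[ℂ] H} (hA : IsStrictlyPositive A) : IsUnit (pow A (-(1 / 2))) :=
  ⟨⟨_, _, invSqrt_mul_sqrt hA, sqrt_mul_invSqrt hA⟩, rfl⟩

omit [FiniteDimensional ℂ H] in
lemma conj_pow_nonneg {A : H →L[ℂ] H} (hA : 0 ≤ A) (B : H →L[ℂ] H) (t : ℝ) :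
    0 ≤ pow B t * A * pow B t :=
  (isSelfAdjoint_pow B t).conjugate_nonneg hA

lemma isStrictlyPositive_conj_invSqrt {A B : H →L[ℂ] H} (hA : IsStrictlyPositive A)
    (hB : IsStrictlyPositive B) :
    IsStrictlyPositive (pow B (-(1 / 2)) * A * pow B (-(1 / 2))) :=
  hA.conjugate_of_isUnit_of_isSelfAdjoint _ _ (isUnit_invSqrt hB) (isSelfAdjoint_pow _ _)

lemma invSqrt_conj_self {B : H →L[ℂ] H} (hB : IsStrictlyPositive B) :
    pow B (-(1 / 2)) * B * pow B (-(1 / 2)) = 1 := by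
  nth_rw 2 [← sqrt_mul_sqrt hB.nonneg]
  rw [← mul_assoc, invSqrt_mul_sqrt hB, one_mul, sqrt_mul_invSqrt hB]

lemma persp_self {B : H →L[ℂ] H} (hB : IsStrictlyPositive B) (φ : ℝ → ℝ) :
    persp φ B B = φ 1 • B := by
  rw [persp, invSqrt_conj_self hB, cfc_apply_one]
  rw [Algebra.algebraMap_eq_smul_one, mul_smul_comm, mul_one, smul_mul_assoc,
    sqrt_mul_sqrt hB.nonneg]

lemma persp_congr {A B : H →L[ℂ] H} (hA : IsStrictlyPositive A) (hB : IsStrictlyPositive B)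
    {φ ψ : ℝ → ℝ} (h : ∀ x, 0 < x → φ x = ψ x) : persp φ A B = persp ψ A B := by
  rw [persp, persp, cfc_congr fun x hx =>
    h x ((isStrictlyPositive_conj_invSqrt hA hB).spectrum_pos hx)]

/-- Exchanging the arguments transposes the function: `A^{-1/2} B A^{-1/2}` is similar to the inverse
of `B^{-1/2} A B^{-1/2}`, and the transpose at `1/x` is `x⁻¹ φ(x)`. -/
lemma persp_transpose {A B : H →L[ℂ] H} (hA : IsStrictlyPositive A)
    (hB : IsStrictlyPositive B) (φ : ℝ → ℝ) : persp (transpose φ) B A = persp φ A B := by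
  obtain ⟨a, ha⟩ : ∃ a, a = pow A (1 / 2) := ⟨_, rfl⟩
  obtain ⟨a', ha'⟩ : ∃ a, a = pow A (-(1 / 2)) := ⟨_, rfl⟩
  obtain ⟨b, hb⟩ : ∃ b, b = pow B (1 / 2) := ⟨_, rfl⟩
  obtain ⟨b', hb'⟩ : ∃ b, b = pow B (-(1 / 2)) := ⟨_, rfl⟩
  have haa : a * a = A := ha ▸ sqrt_mul_sqrt hA.nonneg
  have hbb : b * b = B := hb ▸ sqrt_mul_sqrt hB.nonneg
  have haa' : a * a' = 1 := by rw [ha, ha', sqrt_mul_invSqrt hA]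
  have ha'a : a' * a = 1 := by rw [ha, ha', invSqrt_mul_sqrt hA]
  have hbb' : b * b' = 1 := by rw [hb, hb', sqrt_mul_invSqrt hB]
  have hb'b : b' * b = 1 := by rw [hb, hb', invSqrt_mul_sqrt hB]
  have hX : IsStrictlyPositive (b' * A * b') := hb' ▸ isStrictlyPositive_conj_invSqrt hA hB
  have hY : IsStrictlyPositive (a' * B * a') := ha' ▸ isStrictlyPositive_conj_invSqrt hB hA
  have hinv : cfc (fun x : ℝ => 1 / x) (b' * A * b') = b * a' * (a' * b) := by
    have h1 : (b' * A * b') * cfc (fun x : ℝ => 1 / x) (b' * A * b') = 1 := by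
      nth_rw 1 [← cfc_id' ℝ (b' * A * b') hX.isSelfAdjoint]
      rw [← cfc_mul _ _ _ (continuousOn_real_spectrum _ _) (continuousOn_real_spectrum _ _),
        ← cfc_const_one ℝ (b' * A * b') hX.isSelfAdjoint]
      exact cfc_congr fun x hx => by
        have := (hX.spectrum_pos hx).ne'
        simp [this]
    have h2 : (b * a' * (a' * b)) * (b' * A * b') = 1 := by
      calc (b * a' * (a' * b)) * (b' * A * b')
          = b * a' * (a' * (b * b') * a * a * b') := by rw [← haa]; simp only [mul_assoc]
        _ = b * a' * (a' * a * a * b') := by rw [hbb', mul_one]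
        _ = b * (a' * a) * b' := by
          rw [show a' * a * a = a by rw [ha'a, one_mul]]; simp only [mul_assoc]
        _ = 1 := by rw [ha'a, mul_one, hbb']
    exact (left_inv_eq_right_inv h2 h1).symm
  -- `A^{1/2} B^{-1/2}` intertwines `A^{-1/2} B A^{-1/2}` and the inverse of `B^{-1/2} A B^{-1/2}`.
  have hint : (a' * B * a') * (a * b') = (a * b') * cfc (fun x : ℝ => 1 / x) (b' * A * b') := by
    rw [hinv]
    calc (a' * B * a') * (a * b') = a' * b * (b * (a' * a) * b') := by
          rw [← hbb]; simp only [mul_assoc]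
      _ = a' * b := by rw [ha'a, mul_one, hbb', mul_one]
      _ = a * (b' * b) * a' * (a' * b) := by rw [hb'b, mul_one, haa', one_mul]
      _ = (a * b') * (b * a' * (a' * b)) := by simp only [mul_assoc]
  have hcfc := cfc_mul_of_intertwine hY.isSelfAdjoint (cfc_predicate _ _) hint (transpose φ)
  have hcomp : cfc (transpose φ) (cfc (fun x : ℝ => 1 / x) (b' * A * b')) =
      cfc (fun x : ℝ => 1 / x) (b' * A * b') * cfc φ (b' * A * b') := by
    rw [← cfc_comp' (transpose φ) (fun x : ℝ => 1 / x) _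
        (((finite_real_spectrum _).image _).continuousOn _) (continuousOn_real_spectrum _ _)
        hX.isSelfAdjoint,
      ← cfc_mul _ _ _ (continuousOn_real_spectrum _ _) (continuousOn_real_spectrum _ _)]
    simp [transpose]
  rw [hcomp, hinv] at hcfc
  rw [persp, persp, ← ha, ← ha', ← hb, ← hb']
  have hab : a = a * b' * b := by rw [mul_assoc, hb'b, mul_one]
  calc a * cfc (transpose φ) (a' * B * a') * a
      = a * (cfc (transpose φ) (a' * B * a') * (a * b')) * b := by
        rw [mul_assoc a (_ * _) b, mul_assoc _ (a * b') b, ← hab, mul_assoc]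
    _ = (a * a * (b' * b) * a' * a' * b) * cfc φ (b' * A * b') * b := by
        rw [hcfc]; simp only [mul_assoc]
    _ = b * cfc φ (b' * A * b') * b := by
        rw [hb'b, mul_one, mul_assoc a a a', haa', mul_one, haa', one_mul]

/-- The perspective inequality that combines joint convexity, positive homogeneity and the
transformer inequality. -/
def PerspConvex (H : Type u) [NormedAddCommGroup H] [InnerProductSpace ℂ H] [CompleteSpace H]
    (φ : ℝ → ℝ) : Prop :=
  ∀ A₁ A₂ B₁ B₂ C₁ C₂ : H →L[ℂ] H, IsStrictlyPositive A₁ → IsStrictlyPositive A₂ →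
    IsStrictlyPositive B₁ → IsStrictlyPositive B₂ →
    IsStrictlyPositive (star C₁ * A₁ * C₁ + star C₂ * A₂ * C₂) →
    IsStrictlyPositive (star C₁ * B₁ * C₁ + star C₂ * B₂ * C₂) →
    persp φ (star C₁ * A₁ * C₁ + star C₂ * A₂ * C₂) (star C₁ * B₁ * C₁ + star C₂ * B₂ * C₂) ≤
      star C₁ * persp φ A₁ B₁ * C₁ + star C₂ * persp φ A₂ B₂ * C₂

/-- Jensen's inequality with the weights `V_i = B_i^{1/2} C_i B^{-1/2}`. -/
lemma OperatorConvex.perspConvex {f : ℝ → ℝ} (hf : OperatorConvex.{u} f) : PerspConvex H f := by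
  intro A₁ A₂ B₁ B₂ C₁ C₂ hA₁ hA₂ hB₁ hB₂ _ hB
  obtain ⟨B, hBdef⟩ : ∃ B, B = star C₁ * B₁ * C₁ + star C₂ * B₂ * C₂ := ⟨_, rfl⟩
  rw [← hBdef] at hB ⊢
  obtain ⟨b, hb⟩ : ∃ b, b = pow B (1 / 2) := ⟨_, rfl⟩
  obtain ⟨b', hb'⟩ : ∃ b, b = pow B (-(1 / 2)) := ⟨_, rfl⟩
  have hbs : star b = b := by rw [hb, star_pow]
  have hb's : star b' = b' := by rw [hb', star_pow]
  have hb'b : b' * b = 1 := by rw [hb, hb', invSqrt_mul_sqrt hB]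
  have hbb' : b * b' = 1 := by rw [hb, hb', sqrt_mul_invSqrt hB]
  have key (D C X : H →L[ℂ] H) :
      star (pow D (1 / 2) * C * b') * X * (pow D (1 / 2) * C * b') =
        b' * (star C * (pow D (1 / 2) * X * pow D (1 / 2)) * C) * b' := by
    simp only [star_mul, star_pow, hb's, mul_assoc]
  have hsq {A D : H →L[ℂ] H} (hD : IsStrictlyPositive D) :
      pow D (1 / 2) * (pow D (-(1 / 2)) * A * pow D (-(1 / 2))) * pow D (1 / 2) = A := by
    calc _ = (pow D (1 / 2) * pow D (-(1 / 2))) * A * (pow D (-(1 / 2)) * pow D (1 / 2)) := by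
          simp only [mul_assoc]
      _ = A := by rw [sqrt_mul_invSqrt hD, invSqrt_mul_sqrt hD, one_mul, mul_one]
  have hV : star (pow B₁ (1 / 2) * C₁ * b') * (pow B₁ (1 / 2) * C₁ * b') +
      star (pow B₂ (1 / 2) * C₂ * b') * (pow B₂ (1 / 2) * C₂ * b') = 1 := by
    have h₁ := key B₁ C₁ 1
    have h₂ := key B₂ C₂ 1
    rw [mul_one, mul_one, sqrt_mul_sqrt hB₁.nonneg] at h₁
    rw [mul_one, mul_one, sqrt_mul_sqrt hB₂.nonneg] at h₂
    rw [h₁, h₂, ← add_mul, ← mul_add, ← hBdef, hb', invSqrt_conj_self hB]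
  have hJ := hf.cfc_add_le (isStrictlyPositive_conj_invSqrt hA₁ hB₁)
    (isStrictlyPositive_conj_invSqrt hA₂ hB₂) hV
  rw [key B₁, key B₂, key B₁, key B₂, hsq hB₁, hsq hB₂, ← add_mul, ← mul_add, ← add_mul,
    ← mul_add] at hJ
  have hJ' := star_left_conjugate_le_conjugate hJ b
  rw [hbs] at hJ'
  rw [persp, ← hb, ← hb']
  refine hJ'.trans_eq ?_
  calc b * (b' * (star C₁ * persp f A₁ B₁ * C₁ + star C₂ * persp f A₂ B₂ * C₂) * b') * b
      = (b * b') * (star C₁ * persp f A₁ B₁ * C₁ + star C₂ * persp f A₂ B₂ * C₂) * (b' * b) := by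
        simp only [mul_assoc]
    _ = _ := by rw [hbb', hb'b, one_mul, mul_one]

lemma PerspConvex.transpose {φ : ℝ → ℝ} (h : PerspConvex H φ) :
    PerspConvex H (transpose φ) := by
  intro A₁ A₂ B₁ B₂ C₁ C₂ hA₁ hA₂ hB₁ hB₂ hA hB
  rw [persp_transpose hB hA, persp_transpose hB₁ hA₁, persp_transpose hB₂ hA₂]
  exact h B₁ B₂ A₁ A₂ C₁ C₂ hB₁ hB₂ hA₁ hA₂ hB hA

end Perspective

section Continuity

variable {H : Type u} [NormedAddCommGroup H] [InnerProductSpace ℂ H] [CompleteSpace H]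

/-! ### Continuity of the perspective at invertible second argument -/

lemma tendsto_cfc_of_isStrictlyPositive {ι : Type*} {l : Filter ι} {T : ι → H →L[ℂ] H}
    {T₀ : H →L[ℂ] H} {g : ℝ → ℝ} (hg : ContinuousOn g (Set.Ioi 0)) (hT : Tendsto T l (𝓝 T₀))
    (hpos : ∀ᶠ i in l, IsStrictlyPositive (T i)) (hpos₀ : IsStrictlyPositive T₀) :
    Tendsto (fun i => cfc g (T i)) l (𝓝 (cfc g T₀)) := by
  have h : ContinuousOn (fun A : H →L[ℂ] H => cfc g A) {A | IsStrictlyPositive A} := by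
    refine ContinuousOn.cfc_of_mem_nhdsSet (s := Set.Ioi 0) g ?_ continuousOn_id
      (fun A hA => IsStrictlyPositive.isSelfAdjoint hA) hg
    rw [isOpen_Ioi.mem_nhdsSet]
    exact Set.iUnion₂_subset fun A hA x hx => IsStrictlyPositive.spectrum_pos hA hx
  exact (h T₀ hpos₀).tendsto.comp (tendsto_nhdsWithin_iff.2 ⟨hT, hpos⟩)

lemma tendsto_cfc_of_nonneg {ι : Type*} {l : Filter ι} {T : ι → H →L[ℂ] H}
    {T₀ : H →L[ℂ] H} {g : ℝ → ℝ} (hg : ContinuousOn g (Set.Ici 0)) (hT : Tendsto T l (𝓝 T₀))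
    (hpos : ∀ᶠ i in l, 0 ≤ T i) (hpos₀ : 0 ≤ T₀) :
    Tendsto (fun i => cfc g (T i)) l (𝓝 (cfc g T₀)) := by
  have hcont : Continuous fun x : ℝ => g (max 0 x) :=
    hg.comp_continuous (by fun_prop) fun x => Set.mem_Ici.2 (le_max_left _ _)
  have heq {A : H →L[ℂ] H} (hA : 0 ≤ A) : cfc g A = cfc (fun x => g (max 0 x)) A :=
    cfc_congr fun x hx => by simp [spectrum_nonneg_of_nonneg hA hx]
  have h : ContinuousOn (fun A : H →L[ℂ] H => cfc (fun x => g (max 0 x)) A) {A | 0 ≤ A} :=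
    ContinuousOn.cfc_of_mem_nhdsSet (s := Set.univ) _ univ_mem continuousOn_id
      (fun A hA => IsSelfAdjoint.of_nonneg hA) hcont.continuousOn
  rw [heq hpos₀]
  refine ((h T₀ hpos₀).tendsto.comp (tendsto_nhdsWithin_iff.2 ⟨hT, hpos⟩)).congr' ?_
  filter_upwards [hpos] with i hi using (heq hi).symm

lemma eventually_isStrictlyPositive {ι : Type*} {l : Filter ι} {T : ι → H →L[ℂ] H}
    {T₀ : H →L[ℂ] H} (hT : Tendsto T l (𝓝 T₀)) (hpos : ∀ᶠ i in l, 0 ≤ T i)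
    (hpos₀ : IsStrictlyPositive T₀) : ∀ᶠ i in l, IsStrictlyPositive (T i) := by
  filter_upwards [hpos, hT (Units.isOpen.mem_nhds hpos₀.isUnit)] with i h1 h2
  exact IsUnit.isStrictlyPositive h2 h1

lemma continuousOn_pow_fun (t : ℝ) :
    ContinuousOn (fun a : ℝ => if 0 < a then a ^ t else 0) (Set.Ioi 0) := by
  refine ContinuousOn.congr (f := fun a : ℝ => a ^ t) (fun x hx => ?_) fun x hx => if_pos hx
  exact (Real.continuousAt_rpow_const x t (Or.inl (ne_of_gt hx))).continuousWithinAt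

lemma tendsto_pow {ι : Type*} {l : Filter ι} {T : ι → H →L[ℂ] H} {T₀ : H →L[ℂ] H}
    (hT : Tendsto T l (𝓝 T₀)) (hpos : ∀ᶠ i in l, IsStrictlyPositive (T i))
    (hpos₀ : IsStrictlyPositive T₀) (t : ℝ) :
    Tendsto (fun i => pow (T i) t) l (𝓝 (pow T₀ t)) :=
  tendsto_cfc_of_isStrictlyPositive (continuousOn_pow_fun t) hT hpos hpos₀

variable [FiniteDimensional ℂ H]

lemma tendsto_persp {ι : Type*} {l : Filter ι} {A B : ι → H →L[ℂ] H} {A₀ B₀ : H →L[ℂ] H}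
    {ψ : ℝ → ℝ} (hA : Tendsto A l (𝓝 A₀)) (hB : Tendsto B l (𝓝 B₀))
    (hApos : ∀ᶠ i in l, 0 ≤ A i) (hBpos : ∀ᶠ i in l, 0 ≤ B i) (hA₀ : 0 ≤ A₀)
    (hB₀ : IsStrictlyPositive B₀)
    (hψ : ContinuousOn ψ (Set.Ici 0) ∨ ContinuousOn ψ (Set.Ioi 0) ∧ IsStrictlyPositive A₀) :
    Tendsto (fun i => persp ψ (A i) (B i)) l (𝓝 (persp ψ A₀ B₀)) := by
  have hBs := eventually_isStrictlyPositive hB hBpos hB₀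
  have h1 := tendsto_pow hB hBs hB₀ (1 / 2)
  have h2 := tendsto_pow hB hBs hB₀ (-(1 / 2))
  have hT : Tendsto (fun i => pow (B i) (-(1 / 2)) * A i * pow (B i) (-(1 / 2))) l
      (𝓝 (pow B₀ (-(1 / 2)) * A₀ * pow B₀ (-(1 / 2)))) := (h2.mul hA).mul h2
  refine (h1.mul ?_).mul h1
  rcases hψ with hψ | ⟨hψ, hAs₀⟩
  · refine tendsto_cfc_of_nonneg hψ hT ?_ (conj_pow_nonneg hA₀ _ _)
    filter_upwards [hApos] with i hi using conj_pow_nonneg hi _ _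
  · refine tendsto_cfc_of_isStrictlyPositive hψ hT ?_ (isStrictlyPositive_conj_invSqrt hAs₀ hB₀)
    filter_upwards [hBs, eventually_isStrictlyPositive hA hApos hAs₀] with i hi hi'
    exact isStrictlyPositive_conj_invSqrt hi' hi

lemma persp_mul_of_intertwine {A A' B B' S : H →L[ℂ] H} (hA : IsSelfAdjoint A)
    (hA' : IsSelfAdjoint A') (hB : IsSelfAdjoint B) (hB' : IsSelfAdjoint B')
    (h : A * S = S * A') (h' : B * S = S * B') (φ : ℝ → ℝ) :
    persp φ A B * S = S * persp φ A' B' := by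
  have hp (t : ℝ) : pow B t * S = S * pow B' t := cfc_mul_of_intertwine hB hB' h' _
  have hX : (pow B (-(1 / 2)) * A * pow B (-(1 / 2))) * S =
      S * (pow B' (-(1 / 2)) * A' * pow B' (-(1 / 2))) := by
    rw [mul_assoc _ _ S, hp, ← mul_assoc, mul_assoc _ A S, h, ← mul_assoc, hp]
    simp only [mul_assoc]
  have hc := cfc_mul_of_intertwine (hA.conjugate_self (isSelfAdjoint_pow _ _))
    (hA'.conjugate_self (isSelfAdjoint_pow _ _)) hX φ
  rw [persp, mul_assoc _ _ S, hp, ← mul_assoc, mul_assoc _ _ S, hc, ← mul_assoc, hp, persp]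
  simp only [mul_assoc]

/-! ### Support projections -/

omit [FiniteDimensional ℂ H] in
lemma isSelfAdjoint_supp (A : H →L[ℂ] H) : IsSelfAdjoint (supp A) := isSelfAdjoint_pow A 0

lemma supp_mul_supp (A : H →L[ℂ] H) : supp A * supp A = supp A := by
  rw [supp, pow_mul_pow, add_zero]

lemma isStarProjection_supp (A : H →L[ℂ] H) : IsStarProjection (supp A) :=
  ⟨supp_mul_supp A, isSelfAdjoint_supp A⟩

lemma supp_mul_pow (A : H →L[ℂ] H) (t : ℝ) : supp A * pow A t = pow A t := by
  rw [supp, pow_mul_pow, zero_add]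

lemma supp_mul_self {A : H →L[ℂ] H} (hA : 0 ≤ A) : supp A * A = A := by
  have := supp_mul_pow A 1
  rwa [pow_one hA] at this

lemma mul_supp_of_supp_le {A B : H →L[ℂ] H} (hA : 0 ≤ A) (h : supp A ≤ supp B) :
    A * supp B = A := by
  have h1 : A * supp A = A := by
    have := pow_mul_pow A 1 0
    rwa [add_zero, pow_one hA] at this
  have h2 : supp A * supp B = supp A :=
    ((isStarProjection_supp A).le_iff_mul_eq_left (isStarProjection_supp B)).1 h
  rw [← h1, mul_assoc, h2]

lemma supp_mul_of_supp_le {A B : H →L[ℂ] H} (hA : 0 ≤ A) (h : supp A ≤ supp B) :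
    supp B * A = A := by
  have := congrArg star (mul_supp_of_supp_le hA h)
  rwa [star_mul, (isSelfAdjoint_supp B).star_eq, (IsSelfAdjoint.of_nonneg hA).star_eq] at this

lemma isStrictlyPositive_add_one_sub_supp {A : H →L[ℂ] H} (hA : 0 ≤ A) :
    IsStrictlyPositive (A + (1 - supp A)) := by
  have hsa : IsSelfAdjoint A := IsSelfAdjoint.of_nonneg hA
  have heq : A + (1 - supp A) =
      cfc (fun x : ℝ => x + (1 - if 0 < x then x ^ (0 : ℝ) else 0)) A := by
    rw [cfc_add (a := A) _ _ (continuousOn_real_spectrum _ _) (continuousOn_real_spectrum _ _),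
      cfc_sub _ _ A (continuousOn_real_spectrum _ _) (continuousOn_real_spectrum _ _),
      cfc_id' ℝ A hsa, cfc_const_one ℝ A hsa]
    rfl
  rw [StarOrderedRing.isStrictlyPositive_iff_spectrum_pos (R := ℝ) _
    (hsa.add ((IsSelfAdjoint.one _).sub (isSelfAdjoint_supp A))), heq,
    cfc_map_spectrum _ A hsa (continuousOn_real_spectrum _ _)]
  rintro _ ⟨x, hx, rfl⟩
  rcases (spectrum_nonneg_of_nonneg hA hx).lt_or_eq with h | h
  · simp [h]
  · simp [← h]

/-! ### Limits along block diagonal approximations -/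

/-- Convergence of the perspective when the approximating operators are block diagonal for the
support `S` of `σ` and agree on its complement. There the perspective is `ψ 1 • B`, while on the
range of `S` the limit `σ` is invertible. -/
lemma tendsto_persp_of_block {ι : Type*} {l : Filter ι} {A B : ι → H →L[ℂ] H}
    {ρ σ : H →L[ℂ] H} {ψ : ℝ → ℝ} (hρ : 0 ≤ ρ) (hσ : 0 ≤ σ) (hsupp : supp ρ ≤ supp σ)
    (hA : Tendsto A l (𝓝 ρ)) (hB : Tendsto B l (𝓝 σ))
    (hApos : ∀ i, IsStrictlyPositive (A i)) (hBpos : ∀ i, IsStrictlyPositive (B i))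
    (hAS : ∀ i, A i * supp σ = supp σ * A i) (hBS : ∀ i, B i * supp σ = supp σ * B i)
    (hAB : ∀ i, A i * (1 - supp σ) = B i * (1 - supp σ))
    (hψ : ContinuousOn ψ (Set.Ici 0) ∨ ContinuousOn ψ (Set.Ioi 0) ∧ supp ρ = supp σ) :
    Tendsto (fun i => persp ψ (A i) (B i)) l (𝓝 (persp ψ ρ σ)) := by
  obtain ⟨S, hS⟩ : ∃ S, S = supp σ := ⟨_, rfl⟩
  have hσS : σ * S = σ := hS ▸ mul_supp_of_supp_le hσ le_rfl
  have hSσ : S * σ = σ := hS ▸ supp_mul_self hσ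
  have hρS : ρ * S = ρ := hS ▸ mul_supp_of_supp_le hρ hsupp
  have hSρ : S * ρ = ρ := hS ▸ supp_mul_of_supp_le hρ hsupp
  have hSS : S * S = S := hS ▸ supp_mul_supp σ
  have hproj : IsStarProjection S := hS ▸ isStarProjection_supp σ
  have hσ' : IsStrictlyPositive (σ + (1 - S)) := hS ▸ isStrictlyPositive_add_one_sub_supp hσ
  rw [← hS] at hAS hBS hAB
  have hS1 : 0 ≤ 1 - S := hproj.one_sub.nonneg
  have hconj {X : H →L[ℂ] H} (hX : 0 ≤ X) : 0 ≤ S * X * S + (1 - S) :=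
    add_nonneg (hproj.isSelfAdjoint.conjugate_nonneg hX) hS1
  have hint {X : H →L[ℂ] H} (hX : X * S = S * X) : X * S = S * (S * X * S + (1 - S)) := by
    rw [mul_add, mul_sub, mul_one, hSS, sub_self, add_zero, ← mul_assoc, ← mul_assoc, hSS,
      ← hX, mul_assoc, hSS]
  have hlim {X : ι → H →L[ℂ] H} {X₀ : H →L[ℂ] H} (hX : Tendsto X l (𝓝 X₀)) (h : S * X₀ = X₀)
      (h' : X₀ * S = X₀) :
      Tendsto (fun i => S * X i * S + (1 - S)) l (𝓝 (X₀ + (1 - S))) := by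
    have := ((hX.const_mul S).mul_const S).add_const (1 - S)
    rwa [h, h'] at this
  -- Off the support of `σ` both operators are replaced by the identity.
  have hreg : Tendsto (fun i => persp ψ (S * A i * S + (1 - S)) (S * B i * S + (1 - S))) l
      (𝓝 (persp ψ (ρ + (1 - S)) (σ + (1 - S)))) := by
    refine tendsto_persp (hlim hA hSρ hρS) (hlim hB hSσ hσS)
      (.of_forall fun i => hconj (hApos i).nonneg) (.of_forall fun i => hconj (hBpos i).nonneg)
      (add_nonneg hρ hS1) hσ' (hψ.imp_right fun h => ⟨h.1, ?_⟩)
    rw [hS, ← h.2]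
    exact isStrictlyPositive_add_one_sub_supp hρ
  have hsplit (i : ι) : persp ψ (A i) (B i) =
      S * persp ψ (S * A i * S + (1 - S)) (S * B i * S + (1 - S)) +
        (1 - S) * (ψ 1 • B i) := by
    have hAsa := (hApos i).isSelfAdjoint
    have hBsa := (hBpos i).isSelfAdjoint
    have h1 := persp_mul_of_intertwine hAsa (IsSelfAdjoint.of_nonneg (hconj (hApos i).nonneg))
      hBsa (IsSelfAdjoint.of_nonneg (hconj (hBpos i).nonneg)) (hint (hAS i)) (hint (hBS i)) ψ
    have hc : (1 - S) * B i = B i * (1 - S) := by rw [sub_mul, mul_sub, hBS i, one_mul, mul_one]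
    have h2 := persp_mul_of_intertwine hAsa hBsa hBsa hBsa ((hAB i).trans hc.symm) hc.symm ψ
    rw [persp_self (hBpos i)] at h2
    rw [← h1, ← h2, ← mul_add, add_sub_cancel, mul_one]
  have hL : S * persp ψ (ρ + (1 - S)) (σ + (1 - S)) = persp ψ ρ σ := by
    have hint' {X : H →L[ℂ] H} (h : S * X = X) : X * S = X → S * (X + (1 - S)) = X * S := by
      intro h'
      rw [mul_add, mul_sub, mul_one, hSS, sub_self, add_zero, h, h']
    have h := persp_mul_of_intertwine (IsSelfAdjoint.of_nonneg hρ)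
      (IsSelfAdjoint.of_nonneg (add_nonneg hρ hS1)) (IsSelfAdjoint.of_nonneg hσ)
      hσ'.isSelfAdjoint (hint' hSρ hρS).symm (hint' hSσ hσS).symm ψ
    have hpS : pow σ (1 / 2) * S = pow σ (1 / 2) := by
      rw [hS, supp, pow_mul_pow, add_zero]
    rw [← h, persp, mul_assoc, hpS]
  have hz : (1 - S) * (ψ 1 • σ) = 0 := by
    rw [mul_smul_comm, sub_mul, one_mul, hSσ, sub_self, smul_zero]
  have := (hreg.const_mul S).add ((hB.const_smul (ψ 1)).const_mul (1 - S))
  rw [hL, hz, add_zero] at this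
  exact this.congr fun i => (hsplit i).symm

end Continuity

/-! ### Change of the function -/

section Convergence

variable {H : Type u} [NormedAddCommGroup H] [InnerProductSpace ℂ H] [CompleteSpace H]

lemma PerspTendsto.congr_fun [FiniteDimensional ℂ H] {φ ψ : ℝ → ℝ} {ρ σ L : H →L[ℂ] H}
    (h : PerspTendsto ψ ρ σ L) (hφ : ∀ x, 0 < x → ψ x = φ x) : PerspTendsto φ ρ σ L := by
  intro K hK
  exact (h K hK).congr fun n => persp_congr (hK.left_pos n) (hK.right_pos n) hφ

lemma PerspConvex.congr [FiniteDimensional ℂ H] {φ ψ : ℝ → ℝ} (h : PerspConvex H φ)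
    (hφ : ∀ x, 0 < x → φ x = ψ x) : PerspConvex H ψ := by
  intro A₁ A₂ B₁ B₂ C₁ C₂ hA₁ hA₂ hB₁ hB₂ hA hB
  rw [← persp_congr hA hB hφ, ← persp_congr hA₁ hB₁ hφ, ← persp_congr hA₂ hB₂ hφ]
  exact h A₁ A₂ B₁ B₂ C₁ C₂ hA₁ hA₂ hB₁ hB₂ hA hB

lemma isStrictlyPositive_smul_one {ε : ℝ} (hε : 0 < ε) :
    IsStrictlyPositive (ε • (1 : H →L[ℂ] H)) :=
  isStrictlyPositive_one.smul hε

/-! ### Pinching by a projection -/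

/-- The block diagonal part `S X S + (1 - S) X (1 - S)` of `X`. -/
def pinch (S X : H →L[ℂ] H) : H →L[ℂ] H := S * X * S + (1 - S) * X * (1 - S)

omit [CompleteSpace H] in
lemma pinch_add (S X Y : H →L[ℂ] H) : pinch S (X + Y) = pinch S X + pinch S Y := by
  simp only [pinch, mul_add, add_mul]; abel

omit [CompleteSpace H] in
lemma pinch_sub (S X Y : H →L[ℂ] H) : pinch S (X - Y) = pinch S X - pinch S Y := by
  simp only [pinch, mul_sub, sub_mul]; abel

lemma tendsto_pinch_zero (S : H →L[ℂ] H) {K : ℕ → H →L[ℂ] H} (hK : Tendsto K atTop (𝓝 0)) :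
    Tendsto (fun n => pinch S (K n)) atTop (𝓝 0) := by
  simpa [pinch] using ((hK.const_mul S).mul_const S).add
    ((hK.const_mul (1 - S)).mul_const (1 - S))

omit [CompleteSpace H] in
lemma pinch_eq_self {S X : H →L[ℂ] H} (h : S * X = X) (h' : X * S = X) : pinch S X = X := by
  simp only [pinch, mul_sub, sub_mul, mul_one, one_mul, h, h']; abel

lemma mul_pinch {S : H →L[ℂ] H} (hS : IsStarProjection S) (X : H →L[ℂ] H) :
    S * pinch S X = S * X * S := by
  simp only [pinch, mul_add, ← mul_assoc, mul_sub, mul_one, hS.isIdempotentElem.eq, sub_self,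
    zero_mul, add_zero]

lemma pinch_mul {S : H →L[ℂ] H} (hS : IsStarProjection S) (X : H →L[ℂ] H) :
    pinch S X * S = S * X * S := by
  simp only [pinch, add_mul, mul_assoc, sub_mul, one_mul, hS.isIdempotentElem.eq, sub_self,
    mul_zero, add_zero]

/-- `2 • pinch S X - X` is the conjugate of `X` by the reflection `2 • S - 1`. -/
lemma le_two_smul_pinch {S X : H →L[ℂ] H} (hS : IsStarProjection S) (hX : 0 ≤ X) :
    X ≤ (2 : ℝ) • pinch S X := by
  have h := ((hS.isSelfAdjoint.sub hS.one_sub.isSelfAdjoint)).conjugate_nonneg hX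
  have heq : (S - (1 - S)) * X * (S - (1 - S)) = (2 : ℝ) • pinch S X - X := by
    simp only [pinch, mul_sub, sub_mul, mul_one, one_mul]
    module
  rwa [heq, sub_nonneg] at h

lemma isStrictlyPositive_pinch {S X : H →L[ℂ] H} (hS : IsStarProjection S)
    (hX : IsStrictlyPositive X) : IsStrictlyPositive (pinch S X) := by
  have h := (hX.of_le (le_two_smul_pinch hS hX.nonneg)).smul (c := (1 / 2 : ℝ)) (by norm_num)
  rwa [smul_smul, show (1 / 2 : ℝ) * 2 = 1 by norm_num, one_smul] at h

lemma PerspConvex.persp_pinch_le {ψ : ℝ → ℝ} (h : PerspConvex H ψ) {S A B : H →L[ℂ] H}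
    (hS : IsStarProjection S) (hA : IsStrictlyPositive A) (hB : IsStrictlyPositive B) :
    persp ψ (pinch S A) (pinch S B) ≤ pinch S (persp ψ A B) := by
  have hs : star S = S := hS.isSelfAdjoint
  have hs' : star (1 - S) = 1 - S := hS.one_sub.isSelfAdjoint
  have hA' := isStrictlyPositive_pinch hS hA
  have hB' := isStrictlyPositive_pinch hS hB
  have := h A A B B S (1 - S) hA hA hB hB
  rw [hs, hs'] at this
  exact this hA' hB'

/-! ### Convergence along admissible sequences -/

variable [FiniteDimensional ℂ H]

omit [CompleteSpace H] [FiniteDimensional ℂ H] in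
lemma tendsto_inv_smul_one :
    Tendsto (fun m : ℕ => (1 / ((m : ℝ) + 1)) • (1 : H →L[ℂ] H)) atTop (𝓝 0) := by
  have := (tendsto_one_div_add_atTop_nhds_zero_nat (𝕜 := ℝ)).smul_const (1 : H →L[ℂ] H)
  rwa [zero_smul] at this

/-- Subadditivity of the perspective, with `persp ψ K K = ψ 1 • K`, and a limit to pass from
invertible `ρ`, `σ` and `K` to singular ones. -/
lemma PerspConvex.persp_add_le {ψ : ℝ → ℝ} (h : PerspConvex H ψ)
    (hcont : ContinuousOn ψ (Set.Ioi 0)) {ρ σ K : H →L[ℂ] H} (hρ : 0 ≤ ρ) (hσ : 0 ≤ σ)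
    (hK : 0 ≤ K) (hsupp : supp ρ ≤ supp σ)
    (hψ : ContinuousOn ψ (Set.Ici 0) ∨ supp ρ = supp σ)
    (hρK : IsStrictlyPositive (ρ + K)) (hσK : IsStrictlyPositive (σ + K)) :
    persp ψ (ρ + K) (σ + K) ≤ persp ψ ρ σ + ψ 1 • K := by
  obtain ⟨d, hd⟩ : ∃ d : ℕ → H →L[ℂ] H, d = fun m : ℕ => (1 / ((m : ℝ) + 1)) • 1 := ⟨_, rfl⟩
  have hd0 : Tendsto d atTop (𝓝 0) := hd ▸ tendsto_inv_smul_one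
  have hdpos (m : ℕ) : IsStrictlyPositive (d m) :=
    hd ▸ isStrictlyPositive_smul_one Nat.one_div_pos_of_nat
  have hadd {X : H →L[ℂ] H} (hX : 0 ≤ X) (m : ℕ) : IsStrictlyPositive (X + d m) :=
    (hdpos m).nonneg_add hX
  have hlim (X : H →L[ℂ] H) : Tendsto (fun m => X + d m) atTop (𝓝 X) := by
    simpa using hd0.const_add X
  have hcomm (T : H →L[ℂ] H) (m : ℕ) : d m * T = T * d m := by simp [hd]
  have hle (m : ℕ) : persp ψ ((ρ + d m) + (K + d m)) ((σ + d m) + (K + d m)) ≤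
      persp ψ (ρ + d m) (σ + d m) + ψ 1 • (K + d m) := by
    have := h (ρ + d m) (K + d m) (σ + d m) (K + d m) 1 1 (hadd hρ m) (hadd hK m) (hadd hσ m)
      (hadd hK m)
    simp only [star_one, one_mul, mul_one, persp_self (hadd hK m)] at this
    exact this ((hadd hρ m).add_nonneg (hadd hK m).nonneg)
      ((hadd hσ m).add_nonneg (hadd hK m).nonneg)
  have h1 : Tendsto (fun m => persp ψ ((ρ + d m) + (K + d m)) ((σ + d m) + (K + d m))) atTop
      (𝓝 (persp ψ (ρ + K) (σ + K))) :=
    tendsto_persp ((hlim ρ).add (hlim K)) ((hlim σ).add (hlim K))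
      (.of_forall fun m => add_nonneg (hadd hρ m).nonneg (hadd hK m).nonneg)
      (.of_forall fun m => add_nonneg (hadd hσ m).nonneg (hadd hK m).nonneg)
      hρK.nonneg hσK (Or.inr ⟨hcont, hρK⟩)
  have h2 : Tendsto (fun m => persp ψ (ρ + d m) (σ + d m)) atTop (𝓝 (persp ψ ρ σ)) := by
    refine tendsto_persp_of_block hρ hσ hsupp (hlim ρ) (hlim σ) (hadd hρ) (hadd hσ)
      (fun m => ?_) (fun m => ?_) (fun m => ?_) (hψ.imp_right fun h => ⟨hcont, h⟩)
    · rw [add_mul, mul_add, mul_supp_of_supp_le hρ hsupp, supp_mul_of_supp_le hρ hsupp, hcomm]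
    · rw [add_mul, mul_add, mul_supp_of_supp_le hσ le_rfl, supp_mul_self hσ, hcomm]
    · simp only [add_mul, mul_sub, mul_one, mul_supp_of_supp_le hρ hsupp,
        mul_supp_of_supp_le hσ le_rfl, add_sub_add_left_eq_sub]
  exact le_of_tendsto_of_tendsto' h1 (h2.add ((hlim K).const_smul (ψ 1))) hle

/-- The defect `D = persp ψ ρ σ + ψ 1 • K - persp ψ (ρ + K) (σ + K)` is nonnegative, and its
pinching by the support of `σ` is bounded by a null sequence, so that `D ≤ 2 • pinch D` tends to
zero. -/
lemma PerspConvex.perspTendsto {ψ : ℝ → ℝ} (h : PerspConvex H ψ)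
    (hcont : ContinuousOn ψ (Set.Ioi 0)) {ρ σ : H →L[ℂ] H} (hρ : 0 ≤ ρ) (hσ : 0 ≤ σ)
    (hsupp : supp ρ ≤ supp σ) (hψ : ContinuousOn ψ (Set.Ici 0) ∨ supp ρ = supp σ) :
    PerspTendsto ψ ρ σ (persp ψ ρ σ) := by
  intro K hK
  obtain ⟨S, hS⟩ : ∃ S, S = supp σ := ⟨_, rfl⟩
  have hproj : IsStarProjection S := hS ▸ isStarProjection_supp σ
  have hσS : σ * S = σ := hS ▸ mul_supp_of_supp_le hσ le_rfl
  have hSσ : S * σ = σ := hS ▸ supp_mul_self hσ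
  have hρS : ρ * S = ρ := hS ▸ mul_supp_of_supp_le hρ hsupp
  have hSρ : S * ρ = ρ := hS ▸ supp_mul_of_supp_le hρ hsupp
  have hpinL : pinch S (persp ψ ρ σ) = persp ψ ρ σ := by
    refine pinch_eq_self ?_ ?_
    · rw [persp, ← mul_assoc, ← mul_assoc, hS, supp_mul_pow]
    · rw [persp, mul_assoc, hS, supp, pow_mul_pow, add_zero]
  have hpinK : Tendsto (fun n => pinch S (K n)) atTop (𝓝 0) :=
    tendsto_pinch_zero S hK.tendsto_zero
  have hlimX {X : H →L[ℂ] H} (hX : S * X = X) (hX' : X * S = X) :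
      Tendsto (fun n => pinch S (X + K n)) atTop (𝓝 X) := by
    simp only [pinch_add, pinch_eq_self hX hX']
    simpa using hpinK.const_add X
  have hlow : Tendsto (fun n => persp ψ (pinch S (ρ + K n)) (pinch S (σ + K n))) atTop
      (𝓝 (persp ψ ρ σ)) := by
    refine tendsto_persp_of_block hρ hσ hsupp (hlimX hSρ hρS) (hlimX hSσ hσS)
      (fun n => isStrictlyPositive_pinch hproj (hK.left_pos n))
      (fun n => isStrictlyPositive_pinch hproj (hK.right_pos n))
      (fun n => ?_) (fun n => ?_) (fun n => ?_) (hψ.imp_right fun h => ⟨hcont, h⟩)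
    · rw [← hS, pinch_mul hproj, mul_pinch hproj]
    · rw [← hS, pinch_mul hproj, mul_pinch hproj]
    · rw [← hS, pinch_add, pinch_add, pinch_eq_self hSρ hρS, pinch_eq_self hSσ hσS]
      simp only [add_mul, mul_sub, mul_one, hρS, hσS, add_sub_add_left_eq_sub]
  obtain ⟨D, hD⟩ : ∃ D : ℕ → H →L[ℂ] H,
      D = fun n => persp ψ ρ σ + ψ 1 • K n - persp ψ (ρ + K n) (σ + K n) := ⟨_, rfl⟩
  have hD0 (n : ℕ) : 0 ≤ D n := by
    rw [hD]
    exact sub_nonneg.2 (h.persp_add_le hcont hρ hσ (hK.nonneg n) hsupp hψ (hK.left_pos n)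
      (hK.right_pos n))
  have hDle (n : ℕ) : D n ≤ (2 : ℝ) • (persp ψ ρ σ + pinch S (ψ 1 • K n) -
      persp ψ (pinch S (ρ + K n)) (pinch S (σ + K n))) := by
    refine (le_two_smul_pinch hproj (hD0 n)).trans (smul_le_smul_of_nonneg_left ?_ zero_le_two)
    rw [hD, pinch_sub, pinch_add, hpinL]
    exact sub_le_sub_left (h.persp_pinch_le hproj (hK.left_pos n) (hK.right_pos n)) _
  have hsK : Tendsto (fun n => ψ 1 • K n) atTop (𝓝 0) := by
    simpa using hK.tendsto_zero.const_smul (ψ 1)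
  have hW : Tendsto (fun n => (2 : ℝ) • (persp ψ ρ σ + pinch S (ψ 1 • K n) -
      persp ψ (pinch S (ρ + K n)) (pinch S (σ + K n)))) atTop (𝓝 0) := by
    have h0 := tendsto_pinch_zero S hsK
    simpa using ((h0.const_add (persp ψ ρ σ)).sub hlow).const_smul (2 : ℝ)
  have hDlim : Tendsto D atTop (𝓝 0) :=
    squeeze_zero_norm (fun n => CStarAlgebra.norm_le_norm_of_nonneg_of_le (hD0 n) (hDle n))
      (by simpa using hW.norm)
  have := (hsK.const_add (persp ψ ρ σ)).sub hDlim
  rw [add_zero, sub_zero] at this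
  refine this.congr fun n => ?_
  rw [hD]
  exact sub_sub_cancel _ _

lemma PerspTendsto.transpose {f : ℝ → ℝ} {ρ σ L : H →L[ℂ] H}
    (h : PerspTendsto (transpose f) σ ρ L) : PerspTendsto f ρ σ L := by
  intro K hK
  refine (h K ⟨hK.nonneg, hK.right_pos, hK.left_pos, hK.tendsto_zero⟩).congr fun n => ?_
  exact persp_transpose (hK.left_pos n) (hK.right_pos n) f

omit [FiniteDimensional ℂ H] in
lemma exists_isAdmissible {ρ σ : H →L[ℂ] H} (hρ : 0 ≤ ρ) (hσ : 0 ≤ σ) :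
    ∃ K, IsAdmissible ρ σ K := by
  have hpos (n : ℕ) : IsStrictlyPositive ((1 / ((n : ℝ) + 1)) • (1 : H →L[ℂ] H)) :=
    isStrictlyPositive_smul_one Nat.one_div_pos_of_nat
  exact ⟨fun m : ℕ => (1 / ((m : ℝ) + 1)) • 1, fun n => (hpos n).nonneg,
    fun n => (hpos n).nonneg_add hρ, fun n => (hpos n).nonneg_add hσ, tendsto_inv_smul_one⟩

omit [FiniteDimensional ℂ H] in
lemma PerspTendsto.existsUnique {f : ℝ → ℝ} {ρ σ L : H →L[ℂ] H} (hρ : 0 ≤ ρ) (hσ : 0 ≤ σ)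
    (h : PerspTendsto f ρ σ L) : ∃! L, PerspTendsto f ρ σ L := by
  obtain ⟨K, hK⟩ := exists_isAdmissible hρ hσ
  exact ⟨L, h, fun L' hL' => tendsto_nhds_unique (hL' K hK) (h K hK)⟩

/-! ### Operator convex functions and their transposes near zero -/

lemma OperatorConvex.continuousOn {f : ℝ → ℝ} (hf : OperatorConvex.{u} f) :
    ContinuousOn f (Set.Ioi 0) := by
  refine ConvexOn.continuousOn isOpen_Ioi ⟨convex_Ioi 0, ?_⟩
  intro x hx y hy a b ha hb hab
  obtain rfl : b = 1 - a := by linarith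
  -- Scalar operators on a one-dimensional space living in the universe `u`.
  let E := EuclideanSpace ℂ (ULift.{u} Unit)
  have h := hf E (algebraMap ℝ _ x) (algebraMap ℝ _ y) (isStrictlyPositive_algebraMap hx)
    (isStrictlyPositive_algebraMap hy) a ha (by linarith)
  rw [cfc_algebraMap, cfc_algebraMap, Algebra.smul_def, Algebra.smul_def, Algebra.smul_def,
    Algebra.smul_def, ← map_mul, ← map_mul, ← map_mul, ← map_mul, ← map_add, ← map_add,
    cfc_algebraMap, algebraMap_le_algebraMap] at h
  simpa only [smul_eq_mul] using h

lemma continuousOn_transpose {f : ℝ → ℝ} (hf : ContinuousOn f (Set.Ioi 0)) :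
    ContinuousOn (transpose f) (Set.Ioi 0) := by
  refine continuousOn_id.mul (hf.comp (continuousOn_const.div continuousOn_id ?_) ?_)
  · exact fun x hx => ne_of_gt hx
  · exact fun x hx => Set.mem_Ioi.2 (one_div_pos.2 hx)

lemma extendAtZero_of_pos (f : ℝ → ℝ) (c : ℝ) {x : ℝ} (hx : 0 < x) :
    extendAtZero f c x = f x :=
  Function.update_of_ne hx.ne' _ _

lemma continuousOn_extendAtZero_Ioi {f : ℝ → ℝ} (hf : ContinuousOn f (Set.Ioi 0)) (c : ℝ) :
    ContinuousOn (extendAtZero f c) (Set.Ioi 0) :=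
  hf.congr fun _ hx => extendAtZero_of_pos f c hx

lemma continuousOn_extendAtZero_Ici {f : ℝ → ℝ} (hf : ContinuousOn f (Set.Ioi 0)) {l : ℝ}
    (hl : Tendsto f (𝓝[>] 0) (𝓝 l)) : ContinuousOn (extendAtZero f l) (Set.Ici 0) := by
  intro x hx
  rcases (Set.mem_Ici.1 hx).lt_or_eq with h | h
  · exact ((continuousOn_extendAtZero_Ioi hf l).continuousAt (Ioi_mem_nhds h)).continuousWithinAt
  · subst h
    rw [extendAtZero, continuousWithinAt_update_same, Set.Ici_sdiff_left]
    exact hl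

lemma tendsto_transpose {f : ℝ → ℝ} {l : ℝ} (hl : Tendsto (fun x => f x / x) atTop (𝓝 l)) :
    Tendsto (transpose f) (𝓝[>] 0) (𝓝 l) := by
  refine (hl.comp tendsto_inv_nhdsGT_zero).congr fun x => ?_
  simp [transpose, mul_comm]

lemma PerspConvex.perspTendsto_extendAtZero {φ : ℝ → ℝ} (h : PerspConvex H φ)
    (hcont : ContinuousOn φ (Set.Ioi 0)) {ρ σ : H →L[ℂ] H} (hρ : 0 ≤ ρ) (hσ : 0 ≤ σ)
    (hsupp : supp ρ ≤ supp σ) {c : ℝ} (hc : Tendsto φ (𝓝[>] 0) (𝓝 c) ∨ supp ρ = supp σ) :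
    PerspTendsto φ ρ σ (persp (extendAtZero φ c) ρ σ) :=
  ((h.congr fun _ hx => (extendAtZero_of_pos φ c hx).symm).perspTendsto
    (continuousOn_extendAtZero_Ioi hcont c) hρ hσ hsupp
    (hc.imp_left (continuousOn_extendAtZero_Ici hcont))).congr_fun
      fun _ hx => extendAtZero_of_pos φ c hx

omit [FiniteDimensional ℂ H] in
lemma supp_eq_one {A : H →L[ℂ] H} (hA : IsStrictlyPositive A) : supp A = 1 := pow_zero hA

end Convergence

end OperatorPerspective

end

theorem proposition3p12 {H : Type u} [NormedAddCommGroup H] [InnerProductSpace ℂ H]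
    [CompleteSpace H] [FiniteDimensional ℂ H]
    (f : ℝ → ℝ) (hf : OperatorPerspective.OperatorConvex.{u} f)
    (ρ σ : H →L[ℂ] H) (hρ : 0 ≤ ρ) (hσ : 0 ≤ σ) :
    -- (i) `f(0⁺) = l < ∞` and `ρ⁰ ≤ σ⁰`
    (∀ l : ℝ, Tendsto f (𝓝[>] 0) (𝓝 l) →
      OperatorPerspective.supp ρ ≤ OperatorPerspective.supp σ →
      OperatorPerspective.PerspTendsto f ρ σ
        (OperatorPerspective.persp (OperatorPerspective.extendAtZero f l) ρ σ)) ∧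
    -- (ii) `f'(∞) = l < ∞` and `σ⁰ ≤ ρ⁰`
    (∀ l : ℝ, Tendsto (fun x => f x / x) atTop (𝓝 l) →
      OperatorPerspective.supp σ ≤ OperatorPerspective.supp ρ →
      OperatorPerspective.PerspTendsto f ρ σ
        (OperatorPerspective.persp
          (OperatorPerspective.extendAtZero (OperatorPerspective.transpose f) l) σ ρ)) ∧
    -- (iii) `ρ⁰ = σ⁰`; the value chosen at `0` plays no role
    (OperatorPerspective.supp ρ = OperatorPerspective.supp σ →
      ∀ c : ℝ,
        OperatorPerspective.PerspTendsto f ρ σ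
          (OperatorPerspective.persp (OperatorPerspective.extendAtZero f c) ρ σ) ∧
        OperatorPerspective.PerspTendsto f ρ σ
          (OperatorPerspective.persp
            (OperatorPerspective.extendAtZero (OperatorPerspective.transpose f) c) σ ρ)) ∧
    -- in each of these cases the limit over all admissible sequences is well defined
    ((((∃ l : ℝ, Tendsto f (𝓝[>] 0) (𝓝 l)) ∧
          OperatorPerspective.supp ρ ≤ OperatorPerspective.supp σ) ∨
        ((∃ l : ℝ, Tendsto (fun x => f x / x) atTop (𝓝 l)) ∧
          OperatorPerspective.supp σ ≤ OperatorPerspective.supp ρ) ∨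
        OperatorPerspective.supp ρ = OperatorPerspective.supp σ) →
      ∃! L : H →L[ℂ] H, OperatorPerspective.PerspTendsto f ρ σ L) ∧
    -- and it extends the operator perspective
    (IsStrictlyPositive ρ → IsStrictlyPositive σ →
      OperatorPerspective.PerspTendsto f ρ σ (OperatorPerspective.persp f ρ σ)) := by
  have hconv : OperatorPerspective.PerspConvex H f := hf.perspConvex
  have hcont := hf.continuousOn
  have hconvT := hconv.transpose
  have hcontT := OperatorPerspective.continuousOn_transpose hcont
  have h1 : ∀ l : ℝ, Tendsto f (𝓝[>] 0) (𝓝 l) →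
      OperatorPerspective.supp ρ ≤ OperatorPerspective.supp σ →
      OperatorPerspective.PerspTendsto f ρ σ
        (OperatorPerspective.persp (OperatorPerspective.extendAtZero f l) ρ σ) :=
    fun l hl hs => hconv.perspTendsto_extendAtZero hcont hρ hσ hs (Or.inl hl)
  have h2 : ∀ l : ℝ, Tendsto (fun x => f x / x) atTop (𝓝 l) →
      OperatorPerspective.supp σ ≤ OperatorPerspective.supp ρ →
      OperatorPerspective.PerspTendsto f ρ σ
        (OperatorPerspective.persp
          (OperatorPerspective.extendAtZero (OperatorPerspective.transpose f) l) σ ρ) :=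
    fun l hl hs => (hconvT.perspTendsto_extendAtZero hcontT hσ hρ hs
      (Or.inl (OperatorPerspective.tendsto_transpose hl))).transpose
  have h3 (hs : OperatorPerspective.supp ρ = OperatorPerspective.supp σ) (c : ℝ) :
      OperatorPerspective.PerspTendsto f ρ σ
        (OperatorPerspective.persp (OperatorPerspective.extendAtZero f c) ρ σ) :=
    hconv.perspTendsto_extendAtZero hcont hρ hσ hs.le (Or.inr hs)
  refine ⟨h1, h2, fun hs c => ⟨h3 hs c, ?_⟩, ?_, fun hρ' hσ' => ?_⟩
  · exact (hconvT.perspTendsto_extendAtZero hcontT hσ hρ hs.ge (Or.inr hs.symm)).transpose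
  · rintro (⟨⟨l, hl⟩, hs⟩ | ⟨⟨l, hl⟩, hs⟩ | hs)
    · exact (h1 l hl hs).existsUnique hρ hσ
    · exact (h2 l hl hs).existsUnique hρ hσ
    · exact (h3 hs 0).existsUnique hρ hσ
  · have h := h3 (by rw [OperatorPerspective.supp_eq_one hρ',
      OperatorPerspective.supp_eq_one hσ']) (f 0)
    rwa [OperatorPerspective.extendAtZero, Function.update_eq_self] at h
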